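/- Let $\mathcal H$ be a complex Hilbert space, $\mathcal A\subseteq\mathscr B(\mathcal H)$ a von Neumann algebra and $\tau:\mathcal A\to\mathcal A$ a normal contractive completely positive map. For a linear map $T$ on a von Neumann algebra put $E_\lambda(T)=\{x: T(x)=\lambda x\}$, let $E(T)$ be the linear span of $\bigcup_{|\lambda|=1}E_\lambda(T)$, let $\mathcal P(T)$ be the norm closure of $E(T)$, and let $\tilde T(x\oplus c)=[T(x)+c(1-T(1))]\oplus c$ be the unitization of $T$. Let $(\mathcal K,\mathcal B,\theta)$ be a minimal dilation of $\tau$: $\mathcal K\supseteq\mathcal H$ is a Hilbert space with orthogonal projection $p$ onto $\mathcal H$ (operators $x$ on $\mathcal H$ are identified with $pxp$ on $\mathcal K$); $\mathcal B\subseteq\mathscr B(\mathcal K)$ is a von Neumann algebra with $\mathcal A=p\mathcal Bp$; $\theta:\mathcal B\to\mathcal B$ is a normal, not necessarily unital, $*$-endomorphism; $\tau^n(x)=p\,\theta^n(x)\,p$ for all $x\in\mathcal A$, $n\ge 0$; the vectors $\theta^n(x_n)\cdots\theta(x_1)h$ ($n\ge0$, $x_i\in\mathcal A$, $h\in\mathcal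 H$) span a dense subspace of $\mathcal K$; $\mathcal B$ is the von Neumann algebra generated by $\{\theta^n(x): n\ge 0,\ x\in\mathcal A\}$; and $\tilde\theta$ on $\mathcal B\oplus\mathbb C$ dilates $\tilde\tau$ on $\mathcal A\oplus\mathbb C$ in the same sense, $\tilde\tau^n(y)=(p\oplus1)\,\tilde\theta^n(y)\,(p\oplus1)$ for all $y\in\mathcal A\oplus\mathbb C$, $n\ge 0$ (this last condition is automatic if $\tau$ is unital). Then: 1. If $|\lambda|=1$ and $x\in E_\lambda(\tau)$, there is a unique $\widehat x\in E_\lambda(\theta)$ with $p\widehat xp=x$, and $\widehat x=\lim_{n\to\infty}\lambda^{-n}\theta^n(x)$ in the strong operator topology. 2. The compression $z\mapsto pzp$ restricts to a bijection of $\mathcal P(\theta)$ onto $\mathcal P(\tau)$ which is a complete isometric isomorphism: for every $k$ and every $k\times k$ matrix $(z_{ij})$ over $\mathcal P(\theta)$, $\|(pz_{ij}p)\|=\|(z_{ij})\|$, and $(pz_{ij}p)\ge0$ if and only if $(z_{ij})\ge 0$. 3. $\mathcal P(\theta)$ is a $C^*$-subalgebra of $\mathcal B$. Writing $\widehat x\in\mathcal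 P(\theta)$ for the element with $p\widehat xp=x$ ($x\in\mathcal P(\tau)$), the product $x\circ y=p\,\widehat x\,\widehat y\,p$ makes $\mathcal P(\tau)$, with the norm and involution of $\mathcal A$, a (possibly non-unital, possibly zero) $C^*$-algebra, and $(pzp)\circ(pwp)=p(zw)p$ for $z,w\in\mathcal P(\theta)$. The product $\circ$ does not depend on the choice of the minimal dilation. The $C^*$-algebra $(\mathcal P(\tau),\circ)$ is the peripheral Poisson boundary of $\tau$. -/

import Mathlib

open Filter Topology

namespace PeripheralBoundary

section CPMaps

variable {H : Type*} [NormedAddCommGroup H] [InnerProductSpace ℂ H] [CompleteSpace H]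
  {A : VonNeumannAlgebra H}

/-- Complete positivity of a linear map `τ : A → A`: applying `τ` entrywise to a positive element
of `M_k(A) ⊆ M_k(B(H))` gives a positive element, for every `k`. -/
def IsCompletelyPositive (τ : A.toStarSubalgebra →ₗ[ℂ] A.toStarSubalgebra) : Prop :=
  ∀ (k : ℕ) (M : Fin k → Fin k → A.toStarSubalgebra),
    0 ≤ CStarMatrix.ofMatrix (fun i j => (M i j : H →L[ℂ] H)) →
    0 ≤ CStarMatrix.ofMatrix (fun i j => (τ (M i j) : H →L[ℂ] H))

/-- The normal (ultraweakly continuous) functionals on `A`: those of the form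
`x ↦ ∑ᵢ ⟪ξᵢ, x ηᵢ⟫` with `∑ᵢ ‖ξᵢ‖² < ∞` and `∑ᵢ ‖ηᵢ‖² < ∞`. -/
def IsNormalFunctional (φ : A.toStarSubalgebra → ℂ) : Prop :=
  ∃ ξ η : ℕ → H, (Summable fun i => ‖ξ i‖ ^ 2) ∧ (Summable fun i => ‖η i‖ ^ 2) ∧
    ∀ x : A.toStarSubalgebra,
      HasSum (fun i => inner ℂ (ξ i) ((x : H →L[ℂ] H) (η i))) (φ x)

/-- A map `τ : A → A` is normal if it is continuous for the ultraweak topology, that is, if it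
pulls back normal functionals to normal functionals. -/
def IsNormalMap (τ : A.toStarSubalgebra → A.toStarSubalgebra) : Prop :=
  ∀ φ : A.toStarSubalgebra → ℂ, IsNormalFunctional φ → IsNormalFunctional fun x => φ (τ x)

/-- The eigenspace `E_μ(T) = {x : T x = μ x}`. -/
noncomputable def eigenspace (T : A.toStarSubalgebra →ₗ[ℂ] A.toStarSubalgebra) (μ : ℂ) :
    Submodule ℂ A.toStarSubalgebra :=
  Module.End.eigenspace T μ

/-- `E(T)`: the linear span of the peripheral eigenvectors of `T` (eigenvalue of modulus one). -/
noncomputable def peripheralSpan (T : A.toStarSubalgebra →ₗ[ℂ] A.toStarSubalgebra) :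
    Submodule ℂ A.toStarSubalgebra :=
  Submodule.span ℂ {x | ∃ μ : ℂ, ‖μ‖ = 1 ∧ x ∈ eigenspace T μ}

/-- `P(T)`: the norm closure of `E(T)`. -/
noncomputable def peripheralSpace (T : A.toStarSubalgebra →ₗ[ℂ] A.toStarSubalgebra) :
    Submodule ℂ A.toStarSubalgebra :=
  (peripheralSpan T).topologicalClosure

/-- The unitization `(x, c) ↦ (T x + c (1 - T 1), c)` of `T`, a linear map on `A ⊕ ℂ`. -/
noncomputable def unitization (T : A.toStarSubalgebra →ₗ[ℂ] A.toStarSubalgebra)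
    (y : A.toStarSubalgebra × ℂ) : A.toStarSubalgebra × ℂ :=
  (T y.1 + y.2 • (1 - T 1), y.2)

end CPMaps

section Dilation

variable {H : Type*} [NormedAddCommGroup H] [InnerProductSpace ℂ H] [CompleteSpace H]
  {K : Type*} [NormedAddCommGroup K] [InnerProductSpace ℂ K] [CompleteSpace K]

/-- The operator on `K` which is `x` on `H` (embedded in `K` by `ι`) and `0` on the orthogonal
complement of `H`. -/
noncomputable def extendOp (ι : H →ₗᵢ[ℂ] K) (x : H →L[ℂ] H) : K →L[ℂ] K :=
  ι.toContinuousLinearMap ∘L x ∘L ContinuousLinearMap.adjoint ι.toContinuousLinearMap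

/-- The compression `z ↦ p z p` of an operator on `K` to `H`, as an operator on `H`; here `p` is
the orthogonal projection of `K` onto the range of `ι`. -/
noncomputable def compressOp (ι : H →ₗᵢ[ℂ] K) (z : K →L[ℂ] K) : H →L[ℂ] H :=
  ContinuousLinearMap.adjoint ι.toContinuousLinearMap ∘L z ∘L ι.toContinuousLinearMap

/-- The vectors `θⁿ(xₙ) θⁿ⁻¹(xₙ₋₁) ⋯ θ(x₁) h`, where `j x` is the copy of `x` in the algebra `B`
on which `θ` acts. -/
noncomputable def dilationWord {A : VonNeumannAlgebra H} {B : VonNeumannAlgebra K} (ι : H →ₗᵢ[ℂ] K)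
    (θ : B.toStarSubalgebra → B.toStarSubalgebra)
    (j : A.toStarSubalgebra → B.toStarSubalgebra) (x : ℕ → A.toStarSubalgebra) (h : H) : ℕ → K
  | 0 => ι h
  | n + 1 => (θ^[n + 1] (j (x (n + 1))) : K →L[ℂ] K) (dilationWord ι θ j x h n)

/-- A minimal dilation `(K, B, θ)` of a contractive completely positive map `τ : A → A`,
`A ⊆ B(H)`. The Hilbert space `H` is regarded as a subspace of `K` through the isometry `ι`, and
`x ∈ A` is identified with the operator `p x p` on `K` (`extendOp ι x`). -/
structure MinimalDilation {A : VonNeumannAlgebra H}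
    (τ : A.toStarSubalgebra →ₗ[ℂ] A.toStarSubalgebra)
    (K : Type*) [NormedAddCommGroup K] [InnerProductSpace ℂ K] [CompleteSpace K] where
  /-- The inclusion of `H` in `K`. -/
  ι : H →ₗᵢ[ℂ] K
  /-- The von Neumann algebra on the dilation space. -/
  B : VonNeumannAlgebra K
  /-- The dilating `*`-endomorphism (not assumed unital). -/
  θ : B.toStarSubalgebra →⋆ₙₐ[ℂ] B.toStarSubalgebra
  normal : IsNormalMap (A := B) θ
  extend_mem : ∀ x ∈ A, extendOp ι x ∈ B.toStarSubalgebra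
  compress_mem : ∀ z ∈ B, compressOp ι z ∈ A.toStarSubalgebra
  /-- `τⁿ(x) = p θⁿ(x) p`. -/
  dilates : ∀ (n : ℕ) (x : A.toStarSubalgebra),
    compressOp ι (θ^[n] ⟨extendOp ι x, extend_mem x x.2⟩ : B.toStarSubalgebra) =
      (τ^[n] x : H →L[ℂ] H)
  /-- The unitization of `θ` on `B ⊕ ℂ` dilates the unitization of `τ` on `A ⊕ ℂ`: the minimal
  dilation of a contractive map is the corresponding part of the minimal dilation of its
  unitization. (The `ℂ`-components agree trivially; for unital `τ` this adds nothing.) -/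
  unitization_dilates : ∀ (n : ℕ) (x : A.toStarSubalgebra) (c : ℂ),
    compressOp ι
        ((unitization (A := B) (θ : B.toStarSubalgebra →ₗ[ℂ] B.toStarSubalgebra))^[n]
          (⟨extendOp ι x, extend_mem x x.2⟩, c)).1 =
      (((unitization τ)^[n] (x, c)).1 : H →L[ℂ] H)
  /-- `K` is the closed linear span of the vectors `θⁿ(xₙ) ⋯ θ(x₁) h`. -/
  span_words : (Submodule.span ℂ {k : K | ∃ (n : ℕ) (x : ℕ → A.toStarSubalgebra) (h : H),
    k = dilationWord ι θ (fun a => ⟨extendOp ι a, extend_mem a a.2⟩) x h n}).topologicalClosure = ⊤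
  /-- `B` is the von Neumann algebra generated by all `θⁿ(x)`. -/
  generates : (B : Set (K →L[ℂ] K)) = Set.centralizer (Set.centralizer
    {z : K →L[ℂ] K | ∃ (n : ℕ) (x : A.toStarSubalgebra),
      z = (θ^[n] ⟨extendOp ι x, extend_mem x x.2⟩ : B.toStarSubalgebra)})

namespace MinimalDilation

variable {A : VonNeumannAlgebra H} {τ : A.toStarSubalgebra →ₗ[ℂ] A.toStarSubalgebra}

/-- `θ` as a linear map. -/
noncomputable def endo (D : MinimalDilation τ K) : D.B.toStarSubalgebra →ₗ[ℂ] D.B.toStarSubalgebra :=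
  (D.θ : D.B.toStarSubalgebra →ₗ[ℂ] D.B.toStarSubalgebra)

/-- The copy of `x ∈ A` in `B`. -/
noncomputable def embed (D : MinimalDilation τ K) (x : A.toStarSubalgebra) :
    D.B.toStarSubalgebra :=
  ⟨extendOp D.ι x, D.extend_mem x x.2⟩

/-- The compression map `z ↦ p z p` from `B` to `A`. -/
noncomputable def compress (D : MinimalDilation τ K) :
    D.B.toStarSubalgebra →ₗ[ℂ] A.toStarSubalgebra where
  toFun z := ⟨compressOp D.ι z, D.compress_mem z z.2⟩
  map_add' z w := by
    apply Subtype.ext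
    ext h
    simp [compressOp]
  map_smul' c z := by
    apply Subtype.ext
    ext h
    simp [compressOp]

open Classical in
/-- The lift of `x`: the element `x̂` of `P(θ)` with `p x̂ p = x` (and `0` if there is none). -/
noncomputable def lift (D : MinimalDilation τ K) (x : A.toStarSubalgebra) :
    D.B.toStarSubalgebra :=
  if h : ∃ z ∈ peripheralSpace D.endo, D.compress z = x then h.choose else 0

/-- The extended Choi–Effros product `x ∘ y = p x̂ ŷ p`. -/
noncomputable def circ (D : MinimalDilation τ K) (x y : A.toStarSubalgebra) :
    A.toStarSubalgebra :=
  D.compress (D.lift x * D.lift y)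

end MinimalDilation

/-- The subspace `S` of `A`, with the norm and involution of `A` and the product `m`, is a
(not necessarily unital) `C*`-algebra. -/
structure IsCStarAlgebraFor {A : VonNeumannAlgebra H} (S : Submodule ℂ A.toStarSubalgebra)
    (m : A.toStarSubalgebra → A.toStarSubalgebra → A.toStarSubalgebra) : Prop where
  complete : IsComplete (S : Set A.toStarSubalgebra)
  star_mem : ∀ x ∈ S, star x ∈ S
  mul_mem : ∀ x ∈ S, ∀ y ∈ S, m x y ∈ S
  add_mul : ∀ x ∈ S, ∀ y ∈ S, ∀ z ∈ S, m (x + y) z = m x z + m y z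
  mul_add : ∀ x ∈ S, ∀ y ∈ S, ∀ z ∈ S, m x (y + z) = m x y + m x z
  smul_mul : ∀ (c : ℂ), ∀ x ∈ S, ∀ y ∈ S, m (c • x) y = c • m x y
  mul_smul : ∀ (c : ℂ), ∀ x ∈ S, ∀ y ∈ S, m x (c • y) = c • m x y
  mul_assoc : ∀ x ∈ S, ∀ y ∈ S, ∀ z ∈ S, m (m x y) z = m x (m y z)
  star_mul : ∀ x ∈ S, ∀ y ∈ S, star (m x y) = m (star y) (star x)
  norm_mul_le : ∀ x ∈ S, ∀ y ∈ S, ‖m x y‖ ≤ ‖x‖ * ‖y‖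
  norm_star_mul_self : ∀ x ∈ S, ‖m (star x) x‖ = ‖x‖ ^ 2

end Dilation

end PeripheralBoundary

/-!
Dilating the unitization forces `p θ(1 - p) p = 0`; with minimality this makes `θⁿ(1 - p)` tend
strongly to `0`, so that an eigenvector `w` of `θ` for a unimodular `μ` is the strong limit of
`μ⁻ⁿ θⁿ(p w p)`. Conversely, for a `μ`-eigenvector `x` of `τ` put `v n = μ⁻ⁿ θⁿ(x) h` with `h ∈ H`:
then `⟪v (n + d), v n⟫ = ⟪h, τⁿ(x⋆ x) h⟫ = ‖v n‖²`, so the `v (n + d) - v n` are orthogonal to `v n`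
and `v` is a Cauchy sequence. Since `θ` is normal, strong convergence of `μ⁻ⁿ θⁿ(x a)` passes to the
vectors `θˡ(a) ⋯ h` spanning `K`, and the limit of `μ⁻ⁿ θⁿ(x)` lifts `x`.

There is a filter of `n → ∞` along which `μⁿ → 1` for all unimodular `μ` at once. Along it,
`θⁿ(p z p) → z` strongly for every `z ∈ P(θ)`, so `z` is recovered from `p z p` as a strong limit of
completely positive complete contractions; and `τⁿ(x y) → x ∘ y` there for `x, y ∈ P(τ)`, which
determines the product from `τ` alone.
-/

namespace PeripheralBoundary

section StrongConvergence

variable {α 𝕜 E F G : Type*} [NontriviallyNormedField 𝕜] [NormedAddCommGroup E] [NormedSpace 𝕜 E]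
  [NormedAddCommGroup F] [NormedSpace 𝕜 F] [NormedAddCommGroup G] [NormedSpace 𝕜 G] {l : Filter α}

/-- Convergence of a family of bounded operators in the strong operator topology. -/
def StrongTendsto (T : α → E →L[𝕜] F) (l : Filter α) (S : E →L[𝕜] F) : Prop :=
  ∀ v, Tendsto (fun i => T i v) l (𝓝 (S v))

namespace StrongTendsto

variable {T T' : α → E →L[𝕜] F} {S S' : E →L[𝕜] F} {C : ℝ}

theorem unique [l.NeBot] (h : StrongTendsto T l S) (h' : StrongTendsto T l S') : S = S' :=
  ContinuousLinearMap.ext fun v => tendsto_nhds_unique (h v) (h' v)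

theorem congr (h : StrongTendsto T l S) (hT : ∀ i, T i = T' i) : StrongTendsto T' l S :=
  fun v => (h v).congr fun i => by rw [hT]

theorem sub (h : StrongTendsto T l S) (h' : StrongTendsto T' l S') :
    StrongTendsto (fun i => T i - T' i) l (S - S') :=
  fun v => (h v).sub (h' v)

theorem clm_comp (R : F →L[𝕜] G) (h : StrongTendsto T l S) :
    StrongTendsto (fun i => R ∘L T i) l (R ∘L S) :=
  fun v => (R.continuous.tendsto _).comp (h v)

theorem comp_clm (h : StrongTendsto T l S) (R : G →L[𝕜] E) :
    StrongTendsto (fun i => T i ∘L R) l (S ∘L R) :=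
  fun v => h (R v)

theorem comp_zero {U : α → F →L[𝕜] G} (hU : ∀ i, ‖U i‖ ≤ C) (h : StrongTendsto T l 0) :
    StrongTendsto (fun i => U i ∘L T i) l 0 := by
  intro v
  have hbound := ((h v).norm).const_mul C
  rw [zero_apply, norm_zero, mul_zero] at hbound
  exact squeeze_zero_norm (fun i => (U i).le_of_opNorm_le (hU i) _) hbound

theorem comp {U : α → F →L[𝕜] G} {V : F →L[𝕜] G} (hU : ∀ i, ‖U i‖ ≤ C) (h' : StrongTendsto U l V)
    (h : StrongTendsto T l S) : StrongTendsto (fun i => U i ∘L T i) l (V ∘L S) := by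
  intro v
  have hdiff : StrongTendsto (fun i => T i - S) l 0 := fun w => by
    simpa using (h w).sub_const (S w)
  simpa using (hdiff.comp_zero hU v).add (h' (S v))

theorem opNorm_le [l.NeBot] (h : StrongTendsto T l S) (hT : ∀ i, ‖T i‖ ≤ C) : ‖S‖ ≤ C := by
  obtain ⟨i⟩ := l.nonempty_of_neBot
  exact S.opNorm_le_bound ((norm_nonneg _).trans (hT i)) fun v =>
    le_of_tendsto (h v).norm (Eventually.of_forall fun i => (T i).le_of_opNorm_le (hT i) v)

end StrongTendsto

theorem tendsto_of_mem_closure_span {T : α → E →ₗ[𝕜] F} {S : E →ₗ[𝕜] F} {C : ℝ} {s : Set E}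
    (hT : ∀ i v, ‖T i v‖ ≤ C * ‖v‖) (hS : Continuous S)
    (h : ∀ v ∈ s, Tendsto (fun i => T i v) l (𝓝 (S v))) {v : E}
    (hv : v ∈ (Submodule.span 𝕜 s).topologicalClosure) : Tendsto (fun i => T i v) l (𝓝 (S v)) := by
  have hlip : ∀ i, LipschitzWith C.toNNReal (T i) := fun i =>
    AddMonoidHomClass.lipschitz_of_bound (T i) C (hT i)
  have hclosed : IsClosed {w | Tendsto (fun i => T i w) l (𝓝 (S w))} :=
    (LipschitzWith.uniformEquicontinuous _ _ hlip).equicontinuous.isClosed_setOfPred_tendsto hS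
  refine closure_minimal (fun w hw => ?_) hclosed hv
  induction hw using Submodule.span_induction with
  | mem w hw => exact h w hw
  | zero => simp [tendsto_const_nhds]
  | add w w' _ _ hw hw' => simpa using hw.add hw'
  | smul c w _ hw => simpa using hw.const_smul c

theorem StrongTendsto.of_dense_span {T : α → E →L[𝕜] F} {S : E →L[𝕜] F} {C : ℝ} {s : Set E}
    (hs : (Submodule.span 𝕜 s).topologicalClosure = ⊤) (hT : ∀ i, ‖T i‖ ≤ C)
    (h : ∀ v ∈ s, Tendsto (fun i => T i v) l (𝓝 (S v))) : StrongTendsto T l S := fun _ =>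
  tendsto_of_mem_closure_span (T := fun i => (T i).toLinearMap) (S := S.toLinearMap)
    (fun i => (T i).le_of_opNorm_le (hT i)) S.continuous h (hs ▸ Submodule.mem_top)

theorem cauchySeq_of_dense_span {T : ℕ → E →L[𝕜] F} {C : ℝ} {s : Set E}
    (hs : (Submodule.span 𝕜 s).topologicalClosure = ⊤) (hT : ∀ n, ‖T n‖ ≤ C)
    (h : ∀ v ∈ s, CauchySeq fun n => T n v) (v : E) : CauchySeq fun n => T n v := by
  have hdiff : ∀ w, (CauchySeq fun n => T n w) ↔
      Tendsto (fun p : ℕ × ℕ => (T p.1 - T p.2) w) atTop (𝓝 0) := fun w => by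
    simp only [cauchySeq_iff_tendsto_dist_atTop_0, dist_eq_norm, sub_apply,
      tendsto_zero_iff_norm_tendsto_zero (f := fun p : ℕ × ℕ => T p.1 w - T p.2 w)]
  have hbound : ∀ p : ℕ × ℕ, ‖T p.1 - T p.2‖ ≤ C + C := fun p => norm_sub_le_of_le (hT _) (hT _)
  exact (hdiff v).2 <| StrongTendsto.of_dense_span (S := 0) hs hbound
    (fun w hw => (hdiff w).1 (h w hw)) v

theorem exists_strongTendsto_of_cauchySeq [CompleteSpace E] [CompleteSpace F] {T : ℕ → E →L[𝕜] F}
    (h : ∀ v, CauchySeq fun n => T n v) : ∃ S, StrongTendsto T atTop S := by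
  choose f hf using fun v => cauchySeq_tendsto_of_complete (h v)
  exact ⟨continuousLinearMapOfTendsto T (tendsto_pi_nhds.2 hf), hf⟩

end StrongConvergence

theorem StrongTendsto.isPositive {α 𝕜 E : Type*} [RCLike 𝕜] [NormedAddCommGroup E]
    [InnerProductSpace 𝕜 E] {l : Filter α} [l.NeBot]
    {T : α → E →L[𝕜] E} {S : E →L[𝕜] E} (h : StrongTendsto T l S) (hT : ∀ i, (T i).IsPositive) :
    S.IsPositive := by
  refine ContinuousLinearMap.isPositive_def.2 ⟨fun v w => ?_, fun v => ?_⟩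
  · refine tendsto_nhds_unique ((h v).inner tendsto_const_nhds) ?_
    exact (tendsto_const_nhds.inner (h w)).congr fun i => ((hT i).isSymmetric v w).symm
  · have hinner := (h v).inner (𝕜 := 𝕜) (tendsto_const_nhds (x := v))
    have hre := (RCLike.continuous_re.tendsto _).comp hinner
    exact ge_of_tendsto' hre fun i => (ContinuousLinearMap.isPositive_def.1 (hT i)).2 v

theorem cauchySeq_of_re_inner_eq_norm_sq {𝕜 E : Type*} [RCLike 𝕜] [NormedAddCommGroup E]
    [InnerProductSpace 𝕜 E] {v : ℕ → E} {C : ℝ} (hC : ∀ n, ‖v n‖ ≤ C)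
    (hv : ∀ n d, RCLike.re (inner 𝕜 (v (n + d)) (v n)) = ‖v n‖ ^ 2) : CauchySeq v := by
  have hincr : ∀ n d, ‖v (n + d) - v n‖ ^ 2 = ‖v (n + d)‖ ^ 2 - ‖v n‖ ^ 2 := fun n d => by
    rw [norm_sub_sq (𝕜 := 𝕜), hv]
    ring
  have hmono : Monotone fun n => ‖v n‖ ^ 2 := monotone_nat_of_le_succ fun n => by
    linarith [hincr n 1, sq_nonneg ‖v (n + 1) - v n‖]
  have hbdd : BddAbove (Set.range fun n => ‖v n‖ ^ 2) :=
    ⟨C ^ 2, Set.forall_mem_range.2 fun n => pow_le_pow_left₀ (norm_nonneg _) (hC n) 2⟩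
  have hcauchy := (tendsto_atTop_ciSup hmono hbdd).cauchySeq
  rw [Metric.cauchySeq_iff'] at hcauchy ⊢
  intro ε hε
  obtain ⟨N, hN⟩ := hcauchy (ε ^ 2) (by positivity)
  refine ⟨N, fun n hn => ?_⟩
  obtain ⟨d, rfl⟩ := Nat.exists_eq_add_of_le hn
  have hlt := (le_abs_self _).trans_lt (hN (N + d) hn)
  rw [← hincr] at hlt
  rw [dist_eq_norm]
  exact lt_of_pow_lt_pow_left₀ 2 hε.le hlt

section Recurrence

/-- The filter of neighbourhoods of infinity in `ℕ` along which `n ↦ zⁿ` tends to `1` for all `z` in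
the unit circle simultaneously. It is proper because the powers of an element of the compact group
`Circle → Circle` cluster at the identity. -/
noncomputable def recurrenceFilter : Filter ℕ :=
  comap (fun (n : ℕ) (z : Circle) => z ^ n) (𝓝 1) ⊓ atTop

instance : recurrenceFilter.NeBot :=
  neBot_inf_comap_iff_map'.2 (mapClusterPt_one_atTop_pow fun z : Circle => z)

theorem recurrenceFilter_le_atTop : recurrenceFilter ≤ atTop :=
  inf_le_right

theorem tendsto_pow_recurrenceFilter {μ : ℂ} (hμ : ‖μ‖ = 1) :
    Tendsto (fun n => μ ^ n) recurrenceFilter (𝓝 1) := by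
  have hpow : Tendsto (fun (n : ℕ) (z : Circle) => z ^ n) recurrenceFilter (𝓝 1) :=
    tendsto_comap.mono_left inf_le_left
  have hcoord := tendsto_pi_nhds.1 hpow ⟨μ, by simpa [Submonoid.unitSphere] using hμ⟩
  exact (continuous_subtype_val.tendsto _).comp hcoord

end Recurrence

local instance isClosed_toStarSubalgebra {K : Type*} [NormedAddCommGroup K]
    [InnerProductSpace ℂ K] [CompleteSpace K] (B : VonNeumannAlgebra K) :
    IsClosed (B.toStarSubalgebra : Set (K →L[ℂ] K)) := by
  rw [VonNeumannAlgebra.coe_toStarSubalgebra, ← B.centralizer_centralizer]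
  exact Set.isClosed_centralizer _

section VonNeumannAlgebra

variable {α K : Type*} [NormedAddCommGroup K] [InnerProductSpace ℂ K] [CompleteSpace K]
  {l : Filter α} {B : VonNeumannAlgebra K}

theorem StrongTendsto.mem [l.NeBot] {T : α → K →L[ℂ] K} {S : K →L[ℂ] K}
    (h : StrongTendsto T l S) (hT : ∀ i, T i ∈ B) : S ∈ B := by
  rw [← SetLike.mem_coe, ← B.centralizer_centralizer, Set.mem_centralizer_iff]
  intro R hR
  have hcomm : ∀ i, T i ∘L R = R ∘L T i := fun i => Set.mem_centralizer_iff.1 hR (T i) (hT i)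
  exact (h.clm_comp R).unique ((h.comp_clm R).congr hcomm)

theorem exists_strongTendsto_coe {T : ℕ → B.toStarSubalgebra}
    (h : ∀ v, CauchySeq fun n => (T n : K →L[ℂ] K) v) :
    ∃ S : B.toStarSubalgebra, StrongTendsto (fun n => (T n : K →L[ℂ] K)) atTop S := by
  obtain ⟨S, hS⟩ := exists_strongTendsto_of_cauchySeq h
  exact ⟨⟨S, hS.mem fun n => (T n).2⟩, hS⟩

theorem isNormalFunctional_inner (ξ η : K) :
    IsNormalFunctional (A := B) fun x => inner ℂ ξ ((x : K →L[ℂ] K) η) := by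
  have hsummable : ∀ ζ : K, Summable fun i => ‖(Pi.single 0 ζ : ℕ → K) i‖ ^ 2 := fun ζ =>
    summable_of_ne_finset_zero (s := {0}) fun i hi => by simp_all
  refine ⟨Pi.single 0 ξ, Pi.single 0 η, hsummable ξ, hsummable η, fun x => ?_⟩
  simpa using hasSum_single (f := fun i => inner ℂ ((Pi.single 0 ξ : ℕ → K) i)
    ((x : K →L[ℂ] K) ((Pi.single 0 η : ℕ → K) i))) 0 fun i hi => by simp [hi]

theorem IsNormalFunctional.tendsto {φ : B.toStarSubalgebra → ℂ} (hφ : IsNormalFunctional φ)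
    {T : α → B.toStarSubalgebra} {S : B.toStarSubalgebra} {C : ℝ} (hT : ∀ i, ‖T i‖ ≤ C)
    (h : ∀ ξ η, Tendsto (fun i => inner ℂ ξ ((T i : K →L[ℂ] K) η)) l
      (𝓝 (inner ℂ ξ ((S : K →L[ℂ] K) η)))) :
    Tendsto (fun i => φ (T i)) l (𝓝 (φ S)) := by
  obtain ⟨ξ, η, hξ, hη, hsum⟩ := hφ
  simp_rw [fun x => (hsum x).tsum_eq.symm]
  refine tendsto_tsum_of_dominated_convergence ((hξ.add hη).mul_left C)
    (fun i => h (ξ i) (η i)) (Eventually.of_forall fun n i => ?_)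
  have hC : 0 ≤ C := (norm_nonneg _).trans (hT n)
  calc ‖inner ℂ (ξ i) ((T n : K →L[ℂ] K) (η i))‖
      ≤ ‖ξ i‖ * ‖(T n : K →L[ℂ] K) (η i)‖ := norm_inner_le_norm _ _
    _ ≤ ‖ξ i‖ * (C * ‖η i‖) := by
      gcongr
      exact (T n : K →L[ℂ] K).le_of_opNorm_le (hT n) _
    _ = C * (‖ξ i‖ * ‖η i‖) := by ring
    _ ≤ C * (‖ξ i‖ ^ 2 + ‖η i‖ ^ 2) := by
      gcongr
      nlinarith [two_mul_le_add_sq ‖ξ i‖ ‖η i‖, sq_nonneg ‖ξ i‖, sq_nonneg ‖η i‖]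

theorem IsNormalMap.iterate {ψ : B.toStarSubalgebra → B.toStarSubalgebra} (hψ : IsNormalMap ψ)
    (n : ℕ) : IsNormalMap ψ^[n] := by
  induction n with
  | zero => exact fun φ hφ => hφ
  | succ n ih => exact fun φ hφ => hψ _ (ih φ hφ)

theorem inner_star_mul_apply (z w : B.toStarSubalgebra) (ξ η : K) :
    inner ℂ ξ (((star z * w : B.toStarSubalgebra) : K →L[ℂ] K) η) =
      inner ℂ ((z : K →L[ℂ] K) ξ) ((w : K →L[ℂ] K) η) :=
  ContinuousLinearMap.adjoint_inner_right (z : K →L[ℂ] K) ξ ((w : K →L[ℂ] K) η)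

/-- Normality gives weak continuity, and `‖ψ(v) k‖² = ⟪k, ψ(v* v) k⟫` upgrades it to strong
continuity. -/
theorem IsNormalMap.strongTendsto {ψ : B.toStarSubalgebra →⋆ₙₐ[ℂ] B.toStarSubalgebra}
    (hψ : IsNormalMap (A := B) ψ) {T : α → B.toStarSubalgebra} {S : B.toStarSubalgebra} {C : ℝ}
    (hT : ∀ i, ‖T i‖ ≤ C) (h : StrongTendsto (fun i => (T i : K →L[ℂ] K)) l S) :
    StrongTendsto (fun i => (ψ (T i) : K →L[ℂ] K)) l (ψ S) := by
  intro k
  have hbound : ∀ i, ‖star (T i - S) * (T i - S)‖ ≤ (C + ‖S‖) * (C + ‖S‖) := fun i => by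
    have hsub : ‖T i - S‖ ≤ C + ‖S‖ := norm_sub_le_of_le (hT i) le_rfl
    rw [CStarRing.norm_star_mul_self]
    exact mul_self_le_mul_self (norm_nonneg _) hsub
  have hzero : ∀ v, Tendsto (fun i => ((T i - S : B.toStarSubalgebra) : K →L[ℂ] K) v) l (𝓝 0) :=
    fun v => by simpa using (h v).sub_const ((S : K →L[ℂ] K) v)
  have hweak := (hψ _ (isNormalFunctional_inner k k)).tendsto (S := 0) hbound fun ξ η => by
    simpa only [inner_star_mul_apply, inner_zero_left, ZeroMemClass.coe_zero, zero_apply,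
      inner_zero_right] using (hzero ξ).inner (𝕜 := ℂ) (hzero η)
  simp only [map_mul, map_star, inner_star_mul_apply, map_zero, ZeroMemClass.coe_zero, zero_apply,
    inner_zero_right, inner_self_eq_norm_sq_to_K] at hweak
  rw [tendsto_iff_norm_sub_tendsto_zero]
  have hsq := (tendsto_zero_iff_norm_tendsto_zero.1 hweak).sqrt
  simpa using hsq

end VonNeumannAlgebra

section CStarMatrix

theorem nonneg_of_map_nonneg {A B : Type*} [NonUnitalCStarAlgebra A] [PartialOrder A]
    [StarOrderedRing A] [NonUnitalCStarAlgebra B] [PartialOrder B] [StarOrderedRing B]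
    (φ : A →⋆ₙₐ[ℂ] B) (hφ : Function.Injective φ) {a : A} (ha : 0 ≤ φ a) : 0 ≤ a := by
  have hsa : IsSelfAdjoint a := hφ (by rw [map_star, (IsSelfAdjoint.of_nonneg ha).star_eq])
  have hdec : a⁺ - a⁻ = a := CFC.posPart_sub_negPart a hsa
  have hneg : φ a⁻ = (φ a)⁻ := (CFC.posPart_negPart_unique
    (by rw [← map_sub, hdec]) (by rw [← map_mul, CFC.posPart_mul_negPart, map_zero])
    (map_nonneg φ (CFC.posPart_nonneg a)) (map_nonneg φ (CFC.negPart_nonneg a))).2.symm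
  rw [(CFC.negPart_eq_zero_iff _ (IsSelfAdjoint.of_nonneg ha)).2 ha, map_eq_zero_iff φ hφ] at hneg
  rw [← hdec, hneg, sub_zero]
  exact CFC.posPart_nonneg a

section Map

variable {n A B C : Type*} [Fintype n] [NonUnitalCStarAlgebra A]
  [NonUnitalCStarAlgebra B] [PartialOrder B] [StarOrderedRing B]
  [NonUnitalCStarAlgebra C] [PartialOrder C] [StarOrderedRing C]
  {φ : A →⋆ₙₐ[ℂ] B}

theorem norm_mapₙₐ_le (hφ : Function.Injective φ) (ψ : A →⋆ₙₐ[ℂ] C) (M : CStarMatrix n n A) :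
    ‖CStarMatrix.mapₙₐ ψ M‖ ≤ ‖CStarMatrix.mapₙₐ φ M‖ := by
  let : PartialOrder A := CStarAlgebra.spectralOrder A
  have : StarOrderedRing A := CStarAlgebra.spectralOrderedRing A
  exact (NonUnitalStarAlgHom.norm_apply_le _ M).trans_eq
    (NonUnitalStarAlgHom.norm_map _ (CStarMatrix.map_injective hφ) M).symm

theorem mapₙₐ_nonneg (hφ : Function.Injective φ) (ψ : A →⋆ₙₐ[ℂ] C) {M : CStarMatrix n n A}
    (hM : 0 ≤ CStarMatrix.mapₙₐ φ M) : 0 ≤ CStarMatrix.mapₙₐ ψ M := by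
  let : PartialOrder A := CStarAlgebra.spectralOrder A
  have : StarOrderedRing A := CStarAlgebra.spectralOrderedRing A
  exact map_nonneg _ (nonneg_of_map_nonneg _ (CStarMatrix.map_injective hφ) hM)

end Map

section MatrixOp

variable {n H K : Type*} [Fintype n]
  [NormedAddCommGroup H] [InnerProductSpace ℂ H] [NormedAddCommGroup K] [InnerProductSpace ℂ K]

/-- The operator on the Hilbert sum of copies of `H` given by a matrix of operators on `H`. -/
noncomputable def matrixOp (M : CStarMatrix n n (H →L[ℂ] H)) :
    PiLp 2 (fun _ : n => H) →L[ℂ] PiLp 2 (fun _ : n => H) :=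
  (PiLp.continuousLinearEquiv 2 ℂ (fun _ : n => H)).symm.toContinuousLinearMap ∘L
    ContinuousLinearMap.pi (fun i => ∑ j, M i j ∘L PiLp.proj 2 (fun _ : n => H) j)

theorem matrixOp_apply (M : CStarMatrix n n (H →L[ℂ] H)) (ξ : PiLp 2 (fun _ : n => H)) (i : n) :
    matrixOp M ξ i = ∑ j, M i j (ξ j) := by
  simp [matrixOp]

theorem inner_matrixOp (M : CStarMatrix n n (H →L[ℂ] H)) (ξ η : PiLp 2 (fun _ : n => H)) :
    inner ℂ ξ (matrixOp M η) = ∑ i, ∑ j, inner ℂ (ξ i) (M i j (η j)) := by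
  simp [PiLp.inner_apply, matrixOp_apply, inner_sum]

theorem strongTendsto_matrixOp {α : Type*} {l : Filter α} {M : α → CStarMatrix n n (H →L[ℂ] H)}
    {N : CStarMatrix n n (H →L[ℂ] H)} (h : ∀ i j, StrongTendsto (fun a => M a i j) l (N i j)) :
    StrongTendsto (fun a => matrixOp (M a)) l (matrixOp N) := by
  intro ξ
  have hcoord : Tendsto (fun a i => matrixOp (M a) ξ i) l
      (𝓝 fun i => matrixOp N ξ i) := by
    simp only [matrixOp_apply]
    exact tendsto_pi_nhds.2 fun i => tendsto_finsetSum _ fun j _ => h i j (ξ j)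
  exact ((PiLp.continuous_toLp 2 fun _ : n => H).tendsto _).comp hcoord

/-- The action of an isometry on each summand of a Hilbert sum of copies of its domain. -/
noncomputable def amplify (n : Type*) [Fintype n] (ι : H →ₗᵢ[ℂ] K) :
    PiLp 2 (fun _ : n => H) →ₗᵢ[ℂ] PiLp 2 (fun _ : n => K) where
  toFun ξ := WithLp.toLp 2 fun i => ι (ξ i)
  map_add' ξ η := by
    ext i
    simp
  map_smul' c ξ := by
    ext i
    simp
  norm_map' ξ := by
    simp [PiLp.norm_eq_of_L2]

variable [CompleteSpace H] [CompleteSpace K]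

theorem inner_compressOp (ι : H →ₗᵢ[ℂ] K) (z : K →L[ℂ] K) (ξ η : H) :
    inner ℂ ξ (compressOp ι z η) = inner ℂ (ι ξ) (z (ι η)) :=
  ContinuousLinearMap.adjoint_inner_right ι.toContinuousLinearMap ξ (z (ι η))

theorem norm_compressOp_le (ι : H →ₗᵢ[ℂ] K) (z : K →L[ℂ] K) : ‖compressOp ι z‖ ≤ ‖z‖ := by
  have hadj : ‖ContinuousLinearMap.adjoint ι.toContinuousLinearMap‖ ≤ 1 :=
    (LinearIsometryEquiv.norm_map _ _).trans_le ι.norm_toContinuousLinearMap_le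
  calc ‖compressOp ι z‖
      ≤ ‖ContinuousLinearMap.adjoint ι.toContinuousLinearMap‖ *
          (‖z‖ * ‖ι.toContinuousLinearMap‖) :=
        (ContinuousLinearMap.opNorm_comp_le _ _).trans <| by
          gcongr
          exact ContinuousLinearMap.opNorm_comp_le _ _
    _ ≤ 1 * (‖z‖ * 1) := by
        gcongr
        exact ι.norm_toContinuousLinearMap_le
    _ = ‖z‖ := by rw [one_mul, mul_one]

theorem matrixOp_compressOp (ι : H →ₗᵢ[ℂ] K) (M : CStarMatrix n n (K →L[ℂ] K)) :
    matrixOp (CStarMatrix.ofMatrix fun i j => compressOp ι (M i j)) =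
      compressOp (amplify n ι) (matrixOp M) := by
  refine ContinuousLinearMap.ext fun η => ext_inner_left ℂ fun ξ => ?_
  simp only [inner_compressOp, inner_matrixOp]
  exact Finset.sum_congr rfl fun i _ => Finset.sum_congr rfl fun j _ => inner_compressOp ι _ _ _

/-- `matrixOp` as a `*`-homomorphism, so that the `C*`-theory of injective `*`-homomorphisms
applies to it. -/
noncomputable def matrixOpHom (n H : Type*) [Fintype n] [NormedAddCommGroup H]
    [InnerProductSpace ℂ H] [CompleteSpace H] : CStarMatrix n n (H →L[ℂ] H) →⋆ₙₐ[ℂ]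
      (PiLp 2 (fun _ : n => H) →L[ℂ] PiLp 2 (fun _ : n => H)) where
  toFun := matrixOp
  map_smul' c M := by
    ext ξ i
    simp [matrixOp_apply, Finset.smul_sum]
  map_zero' := by
    ext ξ i
    simp [matrixOp_apply]
  map_add' M N := by
    ext ξ i
    simp [matrixOp_apply, Finset.sum_add_distrib]
  map_mul' M N := by
    ext ξ i
    simp only [matrixOp_apply, CStarMatrix.mul_apply, mul_apply_eq_comp, sum_apply, map_sum]
    exact Finset.sum_comm
  map_star' M := by
    refine ContinuousLinearMap.ext fun η => ext_inner_left ℂ fun ξ => ?_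
    rw [ContinuousLinearMap.star_eq_adjoint, ContinuousLinearMap.adjoint_inner_right,
      inner_matrixOp, ← inner_conj_symm, inner_matrixOp, map_sum, Finset.sum_comm]
    simp only [map_sum, inner_conj_symm, CStarMatrix.star_apply,
      ContinuousLinearMap.star_eq_adjoint, ContinuousLinearMap.adjoint_inner_right]

theorem matrixOpHom_injective : Function.Injective (matrixOpHom n H) := by
  classical
  refine (injective_iff_map_eq_zero _).2 fun M hM => ?_
  ext i j h
  simpa [matrixOpHom, matrixOp_apply, Pi.single_apply, apply_ite] using
    congrArg (fun T => T (WithLp.toLp 2 (Pi.single j h)) i) hM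

theorem norm_matrixOp (M : CStarMatrix n n (H →L[ℂ] H)) : ‖matrixOp M‖ = ‖M‖ :=
  NonUnitalStarAlgHom.norm_map (matrixOpHom n H) matrixOpHom_injective M

theorem isPositive_matrixOp_iff {M : CStarMatrix n n (H →L[ℂ] H)} :
    (matrixOp M).IsPositive ↔ 0 ≤ M := by
  rw [← ContinuousLinearMap.nonneg_iff_isPositive]
  exact ⟨nonneg_of_map_nonneg (matrixOpHom n H) matrixOpHom_injective,
    map_nonneg (matrixOpHom n H)⟩

theorem norm_ofMatrix_compressOp_le (ι : H →ₗᵢ[ℂ] K) (M : CStarMatrix n n (K →L[ℂ] K)) :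
    ‖(CStarMatrix.ofMatrix fun i j => compressOp ι (M i j) : CStarMatrix n n (H →L[ℂ] H))‖ ≤
      ‖M‖ := by
  rw [← norm_matrixOp, ← norm_matrixOp M, matrixOp_compressOp]
  exact norm_compressOp_le _ _

theorem ofMatrix_compressOp_nonneg (ι : H →ₗᵢ[ℂ] K) {M : CStarMatrix n n (K →L[ℂ] K)}
    (hM : 0 ≤ M) : 0 ≤ CStarMatrix.ofMatrix fun i j => compressOp ι (M i j) := by
  rw [← isPositive_matrixOp_iff] at hM ⊢
  rw [matrixOp_compressOp]
  exact hM.adjoint_conj _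

end MatrixOp
end CStarMatrix

section PeripheralSpace

variable {K : Type*} [NormedAddCommGroup K] [InnerProductSpace ℂ K] [CompleteSpace K]
  {B : VonNeumannAlgebra K} {T : B.toStarSubalgebra →ₗ[ℂ] B.toStarSubalgebra}

theorem mem_eigenspace {μ : ℂ} {x : B.toStarSubalgebra} : x ∈ eigenspace T μ ↔ T x = μ • x :=
  Module.End.mem_eigenspace_iff

theorem iterate_of_mem_eigenspace {μ : ℂ} {x : B.toStarSubalgebra} (hx : x ∈ eigenspace T μ)
    (n : ℕ) : T^[n] x = μ ^ n • x := by
  induction n with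
  | zero => simp
  | succ n ih =>
    rw [Function.iterate_succ_apply', ih, map_smul, mem_eigenspace.1 hx, smul_smul, pow_succ]

theorem mem_peripheralSpace_of_mem_eigenspace {μ : ℂ} (hμ : ‖μ‖ = 1) {x : B.toStarSubalgebra}
    (hx : x ∈ eigenspace T μ) : x ∈ peripheralSpace T :=
  Submodule.le_topologicalClosure _ (Submodule.subset_span ⟨μ, hμ, hx⟩)

theorem isComplete_peripheralSpace (T : B.toStarSubalgebra →ₗ[ℂ] B.toStarSubalgebra) :
    IsComplete (peripheralSpace T : Set B.toStarSubalgebra) :=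
  (Submodule.isClosed_topologicalClosure _).isComplete

theorem mul_mem_peripheralSpace (hT : ∀ x y, T (x * y) = T x * T y) {x y : B.toStarSubalgebra}
    (hx : x ∈ peripheralSpace T) (hy : y ∈ peripheralSpace T) : x * y ∈ peripheralSpace T := by
  have hspan : peripheralSpan T * peripheralSpan T ≤ peripheralSpan T := by
    rw [peripheralSpan, Submodule.span_mul_span, Submodule.span_le]
    rintro _ ⟨a, ⟨μ, hμ, ha⟩, b, ⟨ν, hν, hb⟩, rfl⟩
    refine Submodule.subset_span ⟨μ * ν, by rw [norm_mul, hμ, hν, one_mul], ?_⟩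
    rw [mem_eigenspace] at *
    rw [hT, ha, hb, smul_mul_smul_comm]
  exact map_mem_closure₂ continuous_mul hx hy fun a ha b hb => hspan (Submodule.mul_mem_mul ha hb)

theorem star_mem_peripheralSpace (hT : ∀ x, T (star x) = star (T x)) {x : B.toStarSubalgebra}
    (hx : x ∈ peripheralSpace T) : star x ∈ peripheralSpace T := by
  have hspan : peripheralSpan T ≤
      (peripheralSpan T).comap (starLinearEquiv ℂ : B.toStarSubalgebra ≃ₗ⋆[ℂ] _).toLinearMap := by
    refine Submodule.span_le.2 ?_
    rintro a ⟨μ, hμ, ha⟩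
    refine Submodule.subset_span ⟨star μ, by rw [norm_star, hμ], ?_⟩
    rw [mem_eigenspace] at *
    exact (hT a).trans (by rw [ha, star_smul]; rfl)
  exact map_mem_closure continuous_star hx hspan

end PeripheralSpace

section IsCStarAlgebraFor

theorem isComplete_map_of_norm_eq {𝕜 E F : Type*} [NormedField 𝕜] [NormedAddCommGroup E]
    [NormedSpace 𝕜 E] [NormedAddCommGroup F] [NormedSpace 𝕜 F] {S : Submodule 𝕜 E}
    (hS : IsComplete (S : Set E)) {Φ : E →ₗ[𝕜] F} (hΦ : ∀ x ∈ S, ‖Φ x‖ = ‖x‖) :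
    IsComplete (S.map Φ : Set F) := by
  have : CompleteSpace S := hS.completeSpace_coe
  let Ψ : S →ₗᵢ[𝕜] F := ⟨Φ.domRestrict S, fun x => hΦ x x.2⟩
  have hrange : Set.range Ψ = S.map Φ := by
    rw [← LinearMap.range_domRestrict, LinearMap.coe_range]
    rfl
  exact hrange ▸ Ψ.isometry.isUniformInducing.isComplete_range

variable {H : Type*} [NormedAddCommGroup H] [InnerProductSpace ℂ H] [CompleteSpace H]
  {K : Type*} [NormedAddCommGroup K] [InnerProductSpace ℂ K] [CompleteSpace K]
  {A : VonNeumannAlgebra H} {B : VonNeumannAlgebra K} {S : Submodule ℂ B.toStarSubalgebra}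

theorem isCStarAlgebraFor_mul (hS : IsComplete (S : Set B.toStarSubalgebra))
    (hstar : ∀ x ∈ S, star x ∈ S) (hmul : ∀ x ∈ S, ∀ y ∈ S, x * y ∈ S) :
    IsCStarAlgebraFor S fun x y => x * y where
  complete := hS
  star_mem := hstar
  mul_mem := hmul
  add_mul _ _ _ _ _ _ := add_mul _ _ _
  mul_add _ _ _ _ _ _ := mul_add _ _ _
  smul_mul _ _ _ _ _ := smul_mul_assoc _ _ _
  mul_smul _ _ _ _ _ := mul_smul_comm _ _ _
  mul_assoc _ _ _ _ _ _ := mul_assoc _ _ _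
  star_mul _ _ _ _ := star_mul _ _
  norm_mul_le _ _ _ _ := norm_mul_le _ _
  norm_star_mul_self _ _ := by rw [CStarRing.norm_star_mul_self, sq]

theorem IsCStarAlgebraFor.map {m : B.toStarSubalgebra → B.toStarSubalgebra → B.toStarSubalgebra}
    {m' : A.toStarSubalgebra → A.toStarSubalgebra → A.toStarSubalgebra}
    (h : IsCStarAlgebraFor S m) {Φ : B.toStarSubalgebra →ₗ[ℂ] A.toStarSubalgebra}
    (hnorm : ∀ z ∈ S, ‖Φ z‖ = ‖z‖) (hstar : ∀ z ∈ S, Φ (star z) = star (Φ z))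
    (hmul : ∀ z ∈ S, ∀ w ∈ S, m' (Φ z) (Φ w) = Φ (m z w)) : IsCStarAlgebraFor (S.map Φ) m' where
  complete := isComplete_map_of_norm_eq h.complete hnorm
  star_mem := by
    rintro _ ⟨z, hz, rfl⟩
    exact ⟨star z, h.star_mem z hz, hstar z hz⟩
  mul_mem := by
    rintro _ ⟨z, hz, rfl⟩ _ ⟨w, hw, rfl⟩
    exact ⟨m z w, h.mul_mem z hz w hw, (hmul z hz w hw).symm⟩
  add_mul := by
    rintro _ ⟨z, hz, rfl⟩ _ ⟨w, hw, rfl⟩ _ ⟨v, hv, rfl⟩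
    rw [← map_add, hmul _ (S.add_mem hz hw) v hv, h.add_mul z hz w hw v hv, map_add,
      hmul z hz v hv, hmul w hw v hv]
  mul_add := by
    rintro _ ⟨z, hz, rfl⟩ _ ⟨w, hw, rfl⟩ _ ⟨v, hv, rfl⟩
    rw [← map_add, hmul z hz _ (S.add_mem hw hv), h.mul_add z hz w hw v hv, map_add,
      hmul z hz w hw, hmul z hz v hv]
  smul_mul := by
    rintro c _ ⟨z, hz, rfl⟩ _ ⟨w, hw, rfl⟩
    rw [← map_smul, hmul _ (S.smul_mem c hz) w hw, h.smul_mul c z hz w hw, map_smul,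
      hmul z hz w hw]
  mul_smul := by
    rintro c _ ⟨z, hz, rfl⟩ _ ⟨w, hw, rfl⟩
    rw [← map_smul, hmul z hz _ (S.smul_mem c hw), h.mul_smul c z hz w hw, map_smul,
      hmul z hz w hw]
  mul_assoc := by
    rintro _ ⟨z, hz, rfl⟩ _ ⟨w, hw, rfl⟩ _ ⟨v, hv, rfl⟩
    rw [hmul z hz w hw, hmul w hw v hv, hmul _ (h.mul_mem z hz w hw) v hv,
      hmul z hz _ (h.mul_mem w hw v hv), h.mul_assoc z hz w hw v hv]
  star_mul := by
    rintro _ ⟨z, hz, rfl⟩ _ ⟨w, hw, rfl⟩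
    rw [hmul z hz w hw, ← hstar _ (h.mul_mem z hz w hw), h.star_mul z hz w hw, ← hstar z hz,
      ← hstar w hw, hmul _ (h.star_mem w hw) _ (h.star_mem z hz)]
  norm_mul_le := by
    rintro _ ⟨z, hz, rfl⟩ _ ⟨w, hw, rfl⟩
    rw [hmul z hz w hw, hnorm _ (h.mul_mem z hz w hw), hnorm z hz, hnorm w hw]
    exact h.norm_mul_le z hz w hw
  norm_star_mul_self := by
    rintro _ ⟨z, hz, rfl⟩
    rw [← hstar z hz, hmul _ (h.star_mem z hz) z hz,
      hnorm _ (h.mul_mem _ (h.star_mem z hz) z hz), hnorm z hz, h.norm_star_mul_self z hz]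

end IsCStarAlgebraFor

namespace MinimalDilation

variable {H : Type*} [NormedAddCommGroup H] [InnerProductSpace ℂ H] [CompleteSpace H]
  {K : Type*} [NormedAddCommGroup K] [InnerProductSpace ℂ K] [CompleteSpace K]
  {A : VonNeumannAlgebra H} {τ : A.toStarSubalgebra →ₗ[ℂ] A.toStarSubalgebra}
  (D : MinimalDilation τ K)

section Compression

theorem adjoint_ι_apply (h : H) :
    ContinuousLinearMap.adjoint D.ι.toContinuousLinearMap (D.ι h) = h :=
  congrArg (fun T : H →L[ℂ] H => T h) D.ι.adjoint_comp_self

theorem embed_apply (x : A.toStarSubalgebra) (k : K) :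
    (D.embed x : K →L[ℂ] K) k =
      D.ι ((x : H →L[ℂ] H) (ContinuousLinearMap.adjoint D.ι.toContinuousLinearMap k)) :=
  rfl

theorem compress_apply (z : D.B.toStarSubalgebra) (h : H) :
    (D.compress z : H →L[ℂ] H) h =
      ContinuousLinearMap.adjoint D.ι.toContinuousLinearMap ((z : K →L[ℂ] K) (D.ι h)) :=
  rfl

theorem inner_compress (z : D.B.toStarSubalgebra) (h h' : H) :
    inner ℂ h ((D.compress z : H →L[ℂ] H) h') = inner ℂ (D.ι h) ((z : K →L[ℂ] K) (D.ι h')) :=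
  inner_compressOp D.ι z h h'

theorem compress_star (z : D.B.toStarSubalgebra) : D.compress (star z) = star (D.compress z) := by
  apply Subtype.ext
  change compressOp D.ι (ContinuousLinearMap.adjoint _) = ContinuousLinearMap.adjoint _
  simp [compress, compressOp, ContinuousLinearMap.adjoint_comp, ContinuousLinearMap.comp_assoc]

/-- `D.embed` as a (non-unital) `*`-homomorphism. -/
noncomputable def embedHom : A.toStarSubalgebra →⋆ₙₐ[ℂ] D.B.toStarSubalgebra where
  toFun := D.embed
  map_smul' c x := by
    ext k
    simp [embed_apply]
  map_zero' := by
    ext k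
    simp [embed_apply]
  map_add' x y := by
    ext k
    simp [embed_apply]
  map_mul' x y := by
    ext k
    simp [embed_apply, adjoint_ι_apply]
  map_star' x := by
    apply Subtype.ext
    change extendOp D.ι (ContinuousLinearMap.adjoint _) = ContinuousLinearMap.adjoint _
    simp [embed, extendOp, ContinuousLinearMap.adjoint_comp, ContinuousLinearMap.comp_assoc]

theorem embedHom_apply (x : A.toStarSubalgebra) : D.embedHom x = D.embed x := rfl

theorem norm_embed_le (x : A.toStarSubalgebra) : ‖D.embed x‖ ≤ ‖x‖ :=
  NonUnitalStarAlgHom.norm_apply_le D.embedHom x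

theorem norm_compress_le (z : D.B.toStarSubalgebra) : ‖D.compress z‖ ≤ ‖z‖ :=
  norm_compressOp_le D.ι z

theorem compress_embed (x : A.toStarSubalgebra) : D.compress (D.embed x) = x := by
  ext h
  simp [compress_apply, embed_apply, adjoint_ι_apply]

theorem compress_mul_embed (z : D.B.toStarSubalgebra) (x : A.toStarSubalgebra) :
    D.compress (z * D.embed x) = D.compress z * x := by
  ext h
  simp [compress_apply, embed_apply, adjoint_ι_apply]

theorem compress_one : D.compress 1 = 1 := by
  ext h
  simp [compress_apply, adjoint_ι_apply]

/-- The projection `p` of `K` onto `H`. -/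
noncomputable def proj : D.B.toStarSubalgebra := D.embed 1

theorem star_proj : star D.proj = D.proj := by
  rw [proj, ← embedHom_apply, ← map_star, star_one]

theorem proj_mul_embed (x : A.toStarSubalgebra) : D.proj * D.embed x = D.embed x := by
  rw [proj, ← embedHom_apply, ← embedHom_apply, ← map_mul, one_mul]

theorem one_sub_proj_mul_embed (x : A.toStarSubalgebra) : (1 - D.proj) * D.embed x = 0 := by
  rw [sub_mul, one_mul, proj_mul_embed, sub_self]

theorem one_sub_proj_mul_proj : (1 - D.proj) * D.proj = 0 :=
  D.one_sub_proj_mul_embed 1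

theorem proj_apply_ι (h : H) : (D.proj : K →L[ℂ] K) (D.ι h) = D.ι h := by
  simp [proj, embed_apply, adjoint_ι_apply]

theorem embed_compress (z : D.B.toStarSubalgebra) :
    D.embed (D.compress z) = D.proj * z * D.proj := by
  ext k
  simp [proj, embed_apply, compress_apply]

theorem compress_proj_mul_mul_proj (z : D.B.toStarSubalgebra) :
    D.compress (D.proj * z * D.proj) = D.compress z := by
  rw [← embed_compress, compress_embed]

theorem mul_proj_eq_zero_of_compress_star_mul_self {z : D.B.toStarSubalgebra}
    (hz : D.compress (star z * z) = 0) : z * D.proj = 0 := by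
  have hι : ∀ h, (z : K →L[ℂ] K) (D.ι h) = 0 := fun h => by
    have hinner := D.inner_compress (star z * z) h h
    rw [hz, inner_star_mul_apply] at hinner
    exact inner_self_eq_zero.1 (hinner.symm.trans (inner_zero_right h))
  ext k
  simp [proj, embed_apply, hι]

end Compression

section Powers

theorem coe_θ_pow (n : ℕ) : ⇑(D.θ ^ n) = D.endo^[n] :=
  hom_coe_pow DFunLike.coe rfl (fun _ _ => rfl) D.θ n

theorem θ_pow_add_apply (m n : ℕ) (z : D.B.toStarSubalgebra) :
    (D.θ ^ (m + n)) z = (D.θ ^ m) ((D.θ ^ n) z) := by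
  rw [pow_add]
  rfl

theorem isNormalMap_θ_pow (n : ℕ) : IsNormalMap
    (D.θ ^ n : D.B.toStarSubalgebra →⋆ₙₐ[ℂ] D.B.toStarSubalgebra) := by
  rw [coe_θ_pow]
  exact D.normal.iterate n

theorem compress_θ_pow_embed (n : ℕ) (x : A.toStarSubalgebra) :
    D.compress ((D.θ ^ n) (D.embed x)) = τ^[n] x := by
  rw [coe_θ_pow]
  exact Subtype.ext (D.dilates n x)

theorem compress_θ_one_sub_proj : D.compress (D.θ (1 - D.proj)) = 0 := by
  have hproj : D.compress (D.θ D.proj) = τ 1 := D.compress_θ_pow_embed 1 1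
  have hunit : D.compress (D.θ (D.embed 0) + (1 : ℂ) • (1 - D.θ 1)) = τ 0 + (1 : ℂ) • (1 - τ 1) :=
    Subtype.ext (D.unitization_dilates 1 0 1)
  rw [← embedHom_apply, map_zero, map_zero, map_zero, one_smul, one_smul, zero_add, zero_add,
    map_sub, compress_one] at hunit
  rw [map_sub, map_sub, hproj, sub_eq_zero]
  exact sub_right_injective hunit

theorem θ_one_sub_proj_mul_proj : D.θ (1 - D.proj) * D.proj = 0 := by
  apply D.mul_proj_eq_zero_of_compress_star_mul_self
  have hidem : star (1 - D.proj) * (1 - D.proj) = 1 - D.proj := by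
    rw [star_sub, star_one, star_proj, mul_sub, mul_one, one_sub_proj_mul_proj, sub_zero]
  rw [← map_star, ← map_mul, hidem, compress_θ_one_sub_proj]

theorem map_mul_proj {ψ : D.B.toStarSubalgebra →⋆ₙₐ[ℂ] D.B.toStarSubalgebra}
    (hψ : ψ (1 - D.proj) * D.proj = 0) (z : D.B.toStarSubalgebra) :
    ψ z * D.proj = ψ (z * D.proj) * D.proj := by
  rw [← sub_eq_zero, ← sub_mul, ← map_sub, ← mul_one_sub, map_mul, mul_assoc, hψ, mul_zero]

theorem θ_pow_one_sub_proj_mul_proj (n : ℕ) : (D.θ ^ n) (1 - D.proj) * D.proj = 0 := by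
  induction n with
  | zero => exact D.one_sub_proj_mul_proj
  | succ n ih =>
    rw [add_comm, θ_pow_add_apply, pow_one, D.map_mul_proj D.θ_one_sub_proj_mul_proj, ih, map_zero,
      zero_mul]

theorem proj_mul_θ_pow (n : ℕ) (z : D.B.toStarSubalgebra) :
    D.proj * (D.θ ^ n) z = D.proj * (D.θ ^ n) (D.proj * z) := by
  have hstar := congrArg star (D.map_mul_proj (D.θ_pow_one_sub_proj_mul_proj n) (star z))
  simpa only [star_mul, star_proj, ← map_star, star_star] using hstar

theorem compress_θ_pow (n : ℕ) (z : D.B.toStarSubalgebra) :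
    D.compress ((D.θ ^ n) z) = τ^[n] (D.compress z) := by
  calc D.compress ((D.θ ^ n) z) = D.compress (D.proj * ((D.θ ^ n) z * D.proj)) := by
        rw [← mul_assoc, compress_proj_mul_mul_proj]
    _ = D.compress (D.proj * (D.θ ^ n) (D.proj * z * D.proj) * D.proj) := by
        rw [D.map_mul_proj (D.θ_pow_one_sub_proj_mul_proj n), ← mul_assoc, proj_mul_θ_pow,
          mul_assoc D.proj z]
    _ = τ^[n] (D.compress z) := by
        rw [compress_proj_mul_mul_proj, ← embed_compress, compress_θ_pow_embed]

theorem compress_endo (z : D.B.toStarSubalgebra) : D.compress (D.endo z) = τ (D.compress z) :=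
  D.compress_θ_pow 1 z

end Powers

section Words

theorem θ_pow_one_sub_proj_word (xs : ℕ → A.toStarSubalgebra) (h : H) (n d : ℕ) :
    ((D.θ ^ (n + d)) (1 - D.proj) : K →L[ℂ] K) (dilationWord D.ι D.θ D.embed xs h n) = 0 := by
  cases n with
  | zero =>
    have hmul := congrArg (fun z : D.B.toStarSubalgebra => (z : K →L[ℂ] K) (D.ι h))
      (D.θ_pow_one_sub_proj_mul_proj (0 + d))
    simpa [proj_apply_ι, dilationWord] using hmul
  | succ n =>
    have hmul : (D.θ ^ (n + 1 + d)) (1 - D.proj) * (D.θ ^ (n + 1)) (D.embed (xs (n + 1))) = 0 := by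
      rw [θ_pow_add_apply, ← map_mul, ← proj_mul_embed, ← mul_assoc, θ_pow_one_sub_proj_mul_proj,
        zero_mul, map_zero]
    rw [D.coe_θ_pow (n + 1)] at hmul
    exact congrArg (fun z : D.B.toStarSubalgebra => (z : K →L[ℂ] K)
      (dilationWord D.ι D.θ D.embed xs h n)) hmul

theorem strongTendsto_θ_pow_one_sub_proj :
    StrongTendsto (fun n => ((D.θ ^ n) (1 - D.proj) : K →L[ℂ] K)) atTop 0 := by
  refine StrongTendsto.of_dense_span D.span_words
    (fun n => NonUnitalStarAlgHom.norm_apply_le (D.θ ^ n) (1 - D.proj)) ?_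
  rintro _ ⟨n, xs, h, rfl⟩
  refine tendsto_const_nhds.congr' ?_
  filter_upwards [eventually_ge_atTop n] with m hm
  obtain ⟨d, rfl⟩ := Nat.exists_eq_add_of_le hm
  exact (D.θ_pow_one_sub_proj_word xs h n d).symm

end Words

section Rescaled

/-- The rescaled iterates `μ⁻ⁿ θⁿ(x)`, whose strong limit is the lift of a `μ`-eigenvector `x`. -/
noncomputable def rescaled (μ : ℂ) (x : A.toStarSubalgebra) (n : ℕ) : D.B.toStarSubalgebra :=
  (μ ^ n)⁻¹ • (D.θ ^ n) (D.embed x)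

variable {μ : ℂ} {x : A.toStarSubalgebra}

theorem coe_rescaled_apply (n : ℕ) (k : K) : (D.rescaled μ x n : K →L[ℂ] K) k =
    (μ ^ n)⁻¹ • (D.endo^[n] (D.embed x) : K →L[ℂ] K) k := by
  rw [← coe_θ_pow]
  rfl

theorem norm_inv_pow_smul_θ_pow_le (hμ : ‖μ‖ = 1) (n : ℕ) (z : D.B.toStarSubalgebra) :
    ‖(μ ^ n)⁻¹ • (D.θ ^ n) z‖ ≤ ‖z‖ := by
  rw [norm_smul, norm_inv, norm_pow, hμ, one_pow, inv_one, one_mul]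
  exact NonUnitalStarAlgHom.norm_apply_le (D.θ ^ n) z

theorem norm_rescaled_le (hμ : ‖μ‖ = 1) (n : ℕ) : ‖D.rescaled μ x n‖ ≤ ‖x‖ :=
  (D.norm_inv_pow_smul_θ_pow_le hμ n _).trans (D.norm_embed_le x)

theorem inv_pow_smul_θ_pow_of_mem_eigenspace (hμ : ‖μ‖ = 1) {w : D.B.toStarSubalgebra}
    (hw : w ∈ eigenspace D.endo μ) (n : ℕ) : (μ ^ n)⁻¹ • (D.θ ^ n) w = w := by
  have hμ0 : μ ≠ 0 := ne_zero_of_norm_ne_zero (hμ ▸ one_ne_zero)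
  rw [coe_θ_pow, iterate_of_mem_eigenspace hw, inv_smul_smul₀ (pow_ne_zero n hμ0)]

theorem rescaled_compress (hμ : ‖μ‖ = 1) {w : D.B.toStarSubalgebra}
    (hw : w ∈ eigenspace D.endo μ) (n : ℕ) :
    D.rescaled μ (D.compress w) n = w - (D.θ ^ n) (1 - D.proj) * w -
      ((μ ^ n)⁻¹ • (D.θ ^ n) (D.proj * w)) * (D.θ ^ n) (1 - D.proj) := by
  have hsplit : D.proj * w * D.proj = w - (1 - D.proj) * w - D.proj * w * (1 - D.proj) := by
    noncomm_ring
  rw [rescaled, embed_compress, hsplit, map_sub, map_sub, map_mul, map_mul _ (D.proj * w),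
    smul_sub, smul_sub, ← mul_smul_comm, ← smul_mul_assoc,
    D.inv_pow_smul_θ_pow_of_mem_eigenspace hμ hw]

theorem strongTendsto_rescaled_compress (hμ : ‖μ‖ = 1) {w : D.B.toStarSubalgebra}
    (hw : w ∈ eigenspace D.endo μ) :
    StrongTendsto (fun n => (D.rescaled μ (D.compress w) n : K →L[ℂ] K)) atTop w := by
  have hQ := D.strongTendsto_θ_pow_one_sub_proj
  have hleft := hQ.comp_clm (w : K →L[ℂ] K)
  have hright := hQ.comp_zero fun n => D.norm_inv_pow_smul_θ_pow_le hμ n (D.proj * w)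
  have hconst : StrongTendsto (fun _ : ℕ => (w : K →L[ℂ] K)) atTop w := fun _ => tendsto_const_nhds
  have h := (hconst.sub hleft).sub hright
  rw [ContinuousLinearMap.zero_comp, sub_zero, sub_zero] at h
  refine h.congr fun n => ?_
  rw [D.rescaled_compress hμ hw]
  rfl

theorem rescaled_add (m n : ℕ) :
    D.rescaled μ x (m + n) = (μ ^ n)⁻¹ • (D.θ ^ n) (D.rescaled μ x m) := by
  rw [rescaled, rescaled, add_comm, θ_pow_add_apply, map_smul, smul_smul, pow_add, mul_inv]

theorem compress_rescaled (hμ : ‖μ‖ = 1) (hx : x ∈ eigenspace τ μ) (n : ℕ) :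
    D.compress (D.rescaled μ x n) = x := by
  have hμ0 : μ ≠ 0 := ne_zero_of_norm_ne_zero (hμ ▸ one_ne_zero)
  rw [rescaled, map_smul, compress_θ_pow_embed, iterate_of_mem_eigenspace hx,
    inv_smul_smul₀ (pow_ne_zero n hμ0)]

theorem compress_star_rescaled_mul (hμ : ‖μ‖ = 1) (hx : x ∈ eigenspace τ μ) (n d : ℕ) :
    D.compress (star (D.rescaled μ x (n + d)) * D.rescaled μ x n) = τ^[n] (star x * x) := by
  have hunit : star (μ ^ n)⁻¹ * (μ ^ n)⁻¹ = 1 := by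
    rw [Complex.star_def, ← Complex.normSq_eq_conj_mul_self, Complex.normSq_eq_norm_sq, norm_inv,
      norm_pow, hμ, one_pow, inv_one, one_pow, Complex.ofReal_one]
  calc D.compress (star (D.rescaled μ x (n + d)) * D.rescaled μ x n)
      = D.compress ((D.θ ^ n) (star (D.rescaled μ x d) * D.embed x)) := by
        rw [add_comm, rescaled_add, rescaled.eq_def D μ x n, star_smul, smul_mul_smul_comm, hunit,
          one_smul, map_mul (D.θ ^ n), map_star (D.θ ^ n)]
    _ = τ^[n] (star x * x) := by
        rw [compress_θ_pow, compress_mul_embed, compress_star, D.compress_rescaled hμ hx]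

end Rescaled

section Existence

variable {μ : ℂ} {x : A.toStarSubalgebra}

theorem cauchySeq_rescaled_apply_ι (hμ : ‖μ‖ = 1) (hx : x ∈ eigenspace τ μ) (h : H) :
    CauchySeq fun n => (D.rescaled μ x n : K →L[ℂ] K) (D.ι h) := by
  have hinner : ∀ n d, inner ℂ ((D.rescaled μ x (n + d) : K →L[ℂ] K) (D.ι h))
      ((D.rescaled μ x n : K →L[ℂ] K) (D.ι h)) =
      inner ℂ h ((τ^[n] (star x * x) : H →L[ℂ] H) h) := fun n d => by
    rw [← D.compress_star_rescaled_mul hμ hx n d, inner_compress, inner_star_mul_apply]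
  refine cauchySeq_of_re_inner_eq_norm_sq (𝕜 := ℂ)
    (fun n => ContinuousLinearMap.le_of_opNorm_le _ (D.norm_rescaled_le hμ n) _) fun n d => ?_
  rw [hinner, ← hinner n 0, add_zero, inner_self_eq_norm_sq]

theorem exists_strongTendsto_rescaled_mul_embed (hμ : ‖μ‖ = 1) (hx : x ∈ eigenspace τ μ)
    (a : A.toStarSubalgebra) :
    ∃ z : D.B.toStarSubalgebra,
      StrongTendsto (fun n => ((D.rescaled μ x n * D.embed a : D.B.toStarSubalgebra) : K →L[ℂ] K))
        atTop z :=
  exists_strongTendsto_coe fun _ => D.cauchySeq_rescaled_apply_ι hμ hx _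

theorem cauchySeq_rescaled_apply_word (hμ : ‖μ‖ = 1) (hx : x ∈ eigenspace τ μ)
    (xs : ℕ → A.toStarSubalgebra) (h : H) (l : ℕ) :
    CauchySeq fun n => (D.rescaled μ x n : K →L[ℂ] K)
      (dilationWord D.ι D.θ D.embed xs h l) := by
  cases l with
  | zero => exact D.cauchySeq_rescaled_apply_ι hμ hx h
  | succ l =>
    obtain ⟨z, hz⟩ := D.exists_strongTendsto_rescaled_mul_embed hμ hx (xs (l + 1))
    have hbound : ∀ n, ‖D.rescaled μ x n * D.embed (xs (l + 1))‖ ≤ ‖x‖ * ‖xs (l + 1)‖ := fun n =>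
      (norm_mul_le _ _).trans
        (mul_le_mul (D.norm_rescaled_le hμ n) (D.norm_embed_le _) (norm_nonneg _) (norm_nonneg _))
    have hθ := ((D.isNormalMap_θ_pow (l + 1)).strongTendsto hbound hz).clm_comp
      ((μ ^ (l + 1))⁻¹ • ContinuousLinearMap.id ℂ K)
    refine Tendsto.cauchySeq <| (tendsto_add_atTop_iff_nat (l + 1)).1 <|
      (hθ (dilationWord D.ι D.θ D.embed xs h l)).congr fun n => ?_
    rw [rescaled_add]
    simp only [map_mul]
    simp [dilationWord, coe_θ_pow, endo]

theorem exists_strongTendsto_rescaled (hμ : ‖μ‖ = 1) (hx : x ∈ eigenspace τ μ) :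
    ∃ z : D.B.toStarSubalgebra,
      StrongTendsto (fun n => (D.rescaled μ x n : K →L[ℂ] K)) atTop z := by
  refine exists_strongTendsto_coe <|
    cauchySeq_of_dense_span D.span_words (fun n => D.norm_rescaled_le hμ n) ?_
  rintro _ ⟨l, xs, h, rfl⟩
  exact D.cauchySeq_rescaled_apply_word hμ hx xs h l

theorem exists_lift (hμ : ‖μ‖ = 1) (hx : x ∈ eigenspace τ μ) :
    ∃ z ∈ eigenspace D.endo μ, D.compress z = x := by
  have hμ0 : μ ≠ 0 := ne_zero_of_norm_ne_zero (hμ ▸ one_ne_zero)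
  obtain ⟨z, hz⟩ := D.exists_strongTendsto_rescaled hμ hx
  refine ⟨z, mem_eigenspace.2 (Subtype.ext ?_), Subtype.ext ?_⟩
  · have hθz := D.normal.strongTendsto (D.norm_rescaled_le hμ) hz
    refine hθz.unique fun k => ?_
    refine (((tendsto_add_atTop_iff_nat 1).2 (hz k)).const_smul μ).congr fun n => ?_
    simp only [rescaled_add, pow_one, SetLike.val_smul, smul_apply, smul_inv_smul₀ hμ0]
  · have hcompress := (hz.comp_clm D.ι.toContinuousLinearMap).clm_comp
      (ContinuousLinearMap.adjoint D.ι.toContinuousLinearMap)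
    refine hcompress.unique fun h => tendsto_const_nhds.congr fun n => ?_
    exact congrArg (fun y : A.toStarSubalgebra => (y : H →L[ℂ] H) h)
      (D.compress_rescaled hμ hx n).symm

end Existence

section Isometry

theorem norm_θ_pow_embed_le (n : ℕ) (x : A.toStarSubalgebra) : ‖(D.θ ^ n) (D.embed x)‖ ≤ ‖x‖ :=
  (NonUnitalStarAlgHom.norm_apply_le (D.θ ^ n) (D.embed x)).trans (D.norm_embed_le x)

theorem strongTendsto_θ_pow_embed_compress {z : D.B.toStarSubalgebra}
    (hz : z ∈ peripheralSpace D.endo) :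
    StrongTendsto (fun n => ((D.θ ^ n) (D.embed (D.compress z)) : K →L[ℂ] K)) recurrenceFilter
      z := by
  intro k
  let eval : D.B.toStarSubalgebra →L[ℂ] K :=
    ContinuousLinearMap.apply ℂ K k ∘L D.B.toStarSubalgebra.toSubalgebra.toSubmodule.subtypeL
  refine tendsto_of_mem_closure_span (S := eval.toLinearMap) (C := ‖k‖)
    (T := fun n => eval.toLinearMap ∘ₗ ((D.θ ^ n).comp D.embedHom :
      A.toStarSubalgebra →ₗ[ℂ] D.B.toStarSubalgebra) ∘ₗ D.compress)
    (fun n w => ?_) eval.continuous ?_ hz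
  · rw [mul_comm]
    exact ContinuousLinearMap.le_of_opNorm_le _
      ((D.norm_θ_pow_embed_le n _).trans (D.norm_compress_le w)) k
  · rintro w ⟨μ, hμ, hw⟩
    have hμ0 : μ ≠ 0 := ne_zero_of_norm_ne_zero (hμ ▸ one_ne_zero)
    have hlim := (tendsto_pow_recurrenceFilter hμ).smul
      ((D.strongTendsto_rescaled_compress hμ hw k).mono_left recurrenceFilter_le_atTop)
    rw [one_smul] at hlim
    refine hlim.congr fun n => ?_
    simp only [rescaled, SetLike.val_smul, smul_apply, smul_inv_smul₀ (pow_ne_zero n hμ0)]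
    rfl

theorem norm_compress {z : D.B.toStarSubalgebra} (hz : z ∈ peripheralSpace D.endo) :
    ‖D.compress z‖ = ‖z‖ :=
  (D.norm_compress_le z).antisymm <|
    (D.strongTendsto_θ_pow_embed_compress hz).opNorm_le fun n => D.norm_θ_pow_embed_le n _

theorem compress_injOn : Set.InjOn D.compress (peripheralSpace D.endo) := by
  intro z hz w hw h
  rw [← sub_eq_zero, ← norm_eq_zero, ← D.norm_compress (Submodule.sub_mem _ hz hw), map_sub, h,
    sub_self, norm_zero]

theorem compress_mem_eigenspace {μ : ℂ} {w : D.B.toStarSubalgebra}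
    (hw : w ∈ eigenspace D.endo μ) : D.compress w ∈ eigenspace τ μ := by
  rw [mem_eigenspace] at *
  rw [← compress_endo, hw, map_smul]

theorem map_compress_peripheralSpace :
    (peripheralSpace D.endo).map D.compress = peripheralSpace τ := by
  apply le_antisymm
  · have hspan : peripheralSpan D.endo ≤ (peripheralSpan τ).comap D.compress :=
      Submodule.span_le.2 fun w ⟨μ, hμ, hw⟩ =>
        Submodule.subset_span ⟨μ, hμ, D.compress_mem_eigenspace hw⟩
    have hcont : Continuous D.compress :=
      AddMonoidHomClass.continuous_of_bound D.compress 1 fun z =>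
        (D.norm_compress_le z).trans_eq (one_mul _).symm
    exact Submodule.map_le_iff_le_comap.2 fun z hz => map_mem_closure hcont hz hspan
  · have hclosed := (isComplete_map_of_norm_eq (isComplete_peripheralSpace D.endo)
      fun z hz => D.norm_compress hz).isClosed
    refine Submodule.topologicalClosure_minimal _ (Submodule.span_le.2 ?_) hclosed
    rintro x ⟨μ, hμ, hx⟩
    obtain ⟨z, hz, hzx⟩ := D.exists_lift hμ hx
    exact ⟨z, mem_peripheralSpace_of_mem_eigenspace hμ hz, hzx⟩

theorem compress_bijOn : Set.BijOn D.compress (peripheralSpace D.endo) (peripheralSpace τ) := by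
  rw [← D.map_compress_peripheralSpace, Submodule.map_coe]
  exact D.compress_injOn.bijOn_image

end Isometry

section Matrices

variable {n : Type*} [Fintype n]

theorem strongTendsto_matrixOp_θ_pow_embed_compress {Z : n → n → D.B.toStarSubalgebra}
    (hZ : ∀ i j, Z i j ∈ peripheralSpace D.endo) :
    StrongTendsto (fun m => matrixOp (CStarMatrix.ofMatrix fun i j =>
        ((D.θ ^ m) (D.embed (D.compress (Z i j))) : K →L[ℂ] K))) recurrenceFilter
      (matrixOp (CStarMatrix.ofMatrix fun i j => (Z i j : K →L[ℂ] K))) :=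
  strongTendsto_matrixOp fun i j => D.strongTendsto_θ_pow_embed_compress (hZ i j)

theorem norm_ofMatrix_θ_pow_embed_le (m : ℕ) (X : n → n → A.toStarSubalgebra) :
    ‖(CStarMatrix.ofMatrix fun i j => ((D.θ ^ m) (D.embed (X i j)) : K →L[ℂ] K) :
        CStarMatrix n n (K →L[ℂ] K))‖ ≤
      ‖(CStarMatrix.ofMatrix fun i j => (X i j : H →L[ℂ] H) : CStarMatrix n n (H →L[ℂ] H))‖ :=
  norm_mapₙₐ_le (φ := (A.toStarSubalgebra.subtype : A.toStarSubalgebra →⋆ₙₐ[ℂ] H →L[ℂ] H))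
    Subtype.val_injective
    ((D.B.toStarSubalgebra.subtype : D.B.toStarSubalgebra →⋆ₙₐ[ℂ] K →L[ℂ] K).comp
      ((D.θ ^ m).comp D.embedHom)) (CStarMatrix.ofMatrix X)

theorem ofMatrix_θ_pow_embed_nonneg (m : ℕ) {X : n → n → A.toStarSubalgebra}
    (hX : 0 ≤ (CStarMatrix.ofMatrix fun i j => (X i j : H →L[ℂ] H) :
      CStarMatrix n n (H →L[ℂ] H))) :
    0 ≤ (CStarMatrix.ofMatrix fun i j => ((D.θ ^ m) (D.embed (X i j)) : K →L[ℂ] K) :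
      CStarMatrix n n (K →L[ℂ] K)) :=
  mapₙₐ_nonneg (φ := (A.toStarSubalgebra.subtype : A.toStarSubalgebra →⋆ₙₐ[ℂ] H →L[ℂ] H))
    (M := CStarMatrix.ofMatrix X) Subtype.val_injective
    ((D.B.toStarSubalgebra.subtype : D.B.toStarSubalgebra →⋆ₙₐ[ℂ] K →L[ℂ] K).comp
      ((D.θ ^ m).comp D.embedHom)) hX

theorem norm_ofMatrix_compress {Z : n → n → D.B.toStarSubalgebra}
    (hZ : ∀ i j, Z i j ∈ peripheralSpace D.endo) :
    ‖(CStarMatrix.ofMatrix fun i j => (D.compress (Z i j) : H →L[ℂ] H) :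
        CStarMatrix n n (H →L[ℂ] H))‖ =
      ‖(CStarMatrix.ofMatrix fun i j => (Z i j : K →L[ℂ] K) : CStarMatrix n n (K →L[ℂ] K))‖ := by
  refine (norm_ofMatrix_compressOp_le D.ι
    (CStarMatrix.ofMatrix fun i j => (Z i j : K →L[ℂ] K))).antisymm ?_
  rw [← norm_matrixOp]
  refine (D.strongTendsto_matrixOp_θ_pow_embed_compress hZ).opNorm_le fun m => ?_
  rw [norm_matrixOp]
  exact D.norm_ofMatrix_θ_pow_embed_le m _

theorem ofMatrix_compress_nonneg_iff {Z : n → n → D.B.toStarSubalgebra}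
    (hZ : ∀ i j, Z i j ∈ peripheralSpace D.endo) :
    0 ≤ (CStarMatrix.ofMatrix fun i j => (D.compress (Z i j) : H →L[ℂ] H) :
        CStarMatrix n n (H →L[ℂ] H)) ↔
      0 ≤ (CStarMatrix.ofMatrix fun i j => (Z i j : K →L[ℂ] K) :
        CStarMatrix n n (K →L[ℂ] K)) := by
  refine ⟨fun h => ?_, fun h => ofMatrix_compressOp_nonneg D.ι h⟩
  exact isPositive_matrixOp_iff.1 <|
    (D.strongTendsto_matrixOp_θ_pow_embed_compress hZ).isPositive fun m =>
      isPositive_matrixOp_iff.2 (D.ofMatrix_θ_pow_embed_nonneg m h)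

end Matrices

section Product

theorem lift_spec {x : A.toStarSubalgebra} (hx : x ∈ peripheralSpace τ) :
    D.lift x ∈ peripheralSpace D.endo ∧ D.compress (D.lift x) = x := by
  have hex : ∃ z ∈ peripheralSpace D.endo, D.compress z = x := D.compress_bijOn.surjOn hx
  rw [lift, dif_pos hex]
  exact hex.choose_spec

theorem lift_compress {z : D.B.toStarSubalgebra} (hz : z ∈ peripheralSpace D.endo) :
    D.lift (D.compress z) = z :=
  have hlift := D.lift_spec (D.compress_bijOn.mapsTo hz)
  D.compress_injOn hlift.1 hz hlift.2

theorem circ_compress {z w : D.B.toStarSubalgebra} (hz : z ∈ peripheralSpace D.endo)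
    (hw : w ∈ peripheralSpace D.endo) :
    D.circ (D.compress z) (D.compress w) = D.compress (z * w) := by
  rw [circ, D.lift_compress hz, D.lift_compress hw]

theorem isCStarAlgebraFor_endo : IsCStarAlgebraFor (peripheralSpace D.endo) fun z w => z * w :=
  isCStarAlgebraFor_mul (isComplete_peripheralSpace D.endo)
    (fun _ => star_mem_peripheralSpace (map_star D.θ))
    fun _ hz _ => mul_mem_peripheralSpace (map_mul D.θ) hz

theorem isCStarAlgebraFor_circ : IsCStarAlgebraFor (peripheralSpace τ) D.circ := by
  rw [← D.map_compress_peripheralSpace]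
  exact D.isCStarAlgebraFor_endo.map (fun _ => D.norm_compress) (fun z _ => D.compress_star z)
    fun _ hz _ => D.circ_compress hz

theorem strongTendsto_iterate_mul {x y : A.toStarSubalgebra} (hx : x ∈ peripheralSpace τ)
    (hy : y ∈ peripheralSpace τ) :
    StrongTendsto (fun n => (τ^[n] (x * y) : H →L[ℂ] H)) recurrenceFilter (D.circ x y) := by
  have hlim : ∀ {x}, x ∈ peripheralSpace τ →
      StrongTendsto (fun n => ((D.θ ^ n) (D.embed x) : K →L[ℂ] K)) recurrenceFilter (D.lift x) :=
    fun {x} hx => by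
      have hlift := D.lift_spec hx
      simpa only [hlift.2] using D.strongTendsto_θ_pow_embed_compress hlift.1
  have hmul := ((hlim hx).comp (fun n => D.norm_θ_pow_embed_le n x) (hlim hy)).comp_clm
    D.ι.toContinuousLinearMap
  refine (hmul.clm_comp (ContinuousLinearMap.adjoint D.ι.toContinuousLinearMap)).congr fun n => ?_
  have hembed : D.embed (x * y) = D.embed x * D.embed y := map_mul D.embedHom x y
  rw [← compress_θ_pow_embed D n (x * y), hembed, map_mul]
  rfl

theorem circ_eq_circ {K' : Type*} [NormedAddCommGroup K'] [InnerProductSpace ℂ K']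
    [CompleteSpace K'] (D' : MinimalDilation τ K') {x y : A.toStarSubalgebra}
    (hx : x ∈ peripheralSpace τ) (hy : y ∈ peripheralSpace τ) : D'.circ x y = D.circ x y :=
  Subtype.ext <| (D'.strongTendsto_iterate_mul hx hy).unique (D.strongTendsto_iterate_mul hx hy)

end Product

end MinimalDilation

end PeripheralBoundary

theorem mainTheorem2
    {H : Type*} [NormedAddCommGroup H] [InnerProductSpace ℂ H] [CompleteSpace H]
    {K : Type*} [NormedAddCommGroup K] [InnerProductSpace ℂ K] [CompleteSpace K]
    (A : VonNeumannAlgebra H)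
    (τ : A.toStarSubalgebra →ₗ[ℂ] A.toStarSubalgebra)
    (hcp : PeripheralBoundary.IsCompletelyPositive τ)
    (hcontr : ∀ x, ‖τ x‖ ≤ ‖x‖)
    (hnormal : PeripheralBoundary.IsNormalMap τ)
    (D : PeripheralBoundary.MinimalDilation τ K) :
    -- peripheral eigenvectors lift uniquely, by the strong limit of `θⁿ(x) / μⁿ`
    (∀ μ : ℂ, ‖μ‖ = 1 → ∀ x ∈ PeripheralBoundary.eigenspace τ μ,
      ∃ z ∈ PeripheralBoundary.eigenspace D.endo μ,
        D.compress z = x ∧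
        (∀ w ∈ PeripheralBoundary.eigenspace D.endo μ, D.compress w = x → w = z) ∧
        ∀ k : K, Filter.Tendsto
          (fun n : ℕ => (μ ^ n)⁻¹ • (D.endo^[n] (D.embed x) : K →L[ℂ] K) k)
          Filter.atTop (nhds ((z : K →L[ℂ] K) k))) ∧
    -- the compression is a complete isometric (order) isomorphism of `P(θ)` onto `P(τ)`
    (Set.BijOn D.compress (PeripheralBoundary.peripheralSpace D.endo)
        (PeripheralBoundary.peripheralSpace τ) ∧
      ∀ (k : ℕ) (Z : Fin k → Fin k → D.B.toStarSubalgebra),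
        (∀ i j, Z i j ∈ PeripheralBoundary.peripheralSpace D.endo) →
        ‖CStarMatrix.ofMatrix (fun i j => (D.compress (Z i j) : H →L[ℂ] H))‖ =
            ‖CStarMatrix.ofMatrix (fun i j => (Z i j : K →L[ℂ] K))‖ ∧
        (0 ≤ CStarMatrix.ofMatrix (fun i j => (D.compress (Z i j) : H →L[ℂ] H)) ↔
          0 ≤ CStarMatrix.ofMatrix (fun i j => (Z i j : K →L[ℂ] K)))) ∧
    -- `P(θ)` is a `C*`-subalgebra of `B`, and transporting its product to `P(τ)` makes the latter
    -- a `C*`-algebra; the product on `P(τ)` does not depend on the minimal dilation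
    (PeripheralBoundary.IsCStarAlgebraFor (PeripheralBoundary.peripheralSpace D.endo)
        (fun z w => z * w) ∧
      (∀ x ∈ PeripheralBoundary.peripheralSpace τ,
        D.lift x ∈ PeripheralBoundary.peripheralSpace D.endo ∧ D.compress (D.lift x) = x) ∧
      (∀ z ∈ PeripheralBoundary.peripheralSpace D.endo,
        ∀ w ∈ PeripheralBoundary.peripheralSpace D.endo,
          D.circ (D.compress z) (D.compress w) = D.compress (z * w)) ∧
      PeripheralBoundary.IsCStarAlgebraFor (PeripheralBoundary.peripheralSpace τ) D.circ ∧
      ∀ (K' : Type*) [NormedAddCommGroup K'] [InnerProductSpace ℂ K'] [CompleteSpace K']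
        (D' : PeripheralBoundary.MinimalDilation τ K'),
        ∀ x ∈ PeripheralBoundary.peripheralSpace τ,
          ∀ y ∈ PeripheralBoundary.peripheralSpace τ, D'.circ x y = D.circ x y) := by
  refine ⟨fun μ hμ x hx => ?_,
    ⟨D.compress_bijOn, fun k Z hZ =>
      ⟨D.norm_ofMatrix_compress hZ, D.ofMatrix_compress_nonneg_iff hZ⟩⟩,
    D.isCStarAlgebraFor_endo, fun x hx => D.lift_spec hx, fun z hz w hw => D.circ_compress hz hw,
    D.isCStarAlgebraFor_circ, fun K' _ _ _ D' x hx y hy => D.circ_eq_circ D' hx hy⟩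
  obtain ⟨z, hz, rfl⟩ := D.exists_lift hμ hx
  refine ⟨z, hz, rfl, fun w hw hwz => ?_, fun k => ?_⟩
  · exact D.compress_injOn (PeripheralBoundary.mem_peripheralSpace_of_mem_eigenspace hμ hw)
      (PeripheralBoundary.mem_peripheralSpace_of_mem_eigenspace hμ hz) hwz
  · simpa only [D.coe_rescaled_apply] using D.strongTendsto_rescaled_compress hμ hz k
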